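/- Let $m:\mathbb{R}^d\to[0,1]$ be a $\gamma_m$-Lipschitz function (Euclidean norm), and let $M$ be a random function $\mathbb{R}^d\to[0,1]$ (each $M(z)$, $z\in\mathbb{R}^d$, is a random variable; for example, $M$ takes finitely many values). Suppose that $M$ is a naturally-occurring change of the model $m$, i.e. 1. $\mathbb{E}[M(z)]=m(z)$ for every fixed $z\in\mathbb{R}^d$; 2. $m$ being $\gamma_m$-Lipschitz, every realization of $M$ is $\gamma$-Lipschitz, with a constant $\gamma\ge 0$ that does not depend on the realization; 3. $\operatorname{Var}(M(z))\le\nu$ for every $z$ in the data manifold $\mathcal{X}\subseteq\mathbb{R}^d$, where $\nu$ is a constant. Let $k\ge1$, $x\in\mathbb{R}^d$, $\sigma>0$, let $X_1,\dots,X_k$ be i.i.d. with distribution $\mathcal{N}(x,\sigma^2 I_d)$, with $(X_1,\dots,X_k)$ independent of $M$, and put $$Z=\frac1k\sum_{i=1}^k\bigl(m(X_i)-M(X_i)\bigr).$$ Then $Z$ is integrable and $\mathbb{E}[Z]=0$. Moreover, if $\varepsilon'$ is a real number with $|\mathbb{E}[Z\mid M]-\mathbb{E}[Z]|<\varepsilon'$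 almost surely, where $\mathbb{E}[Z\mid M]$ is the conditional expectation given the $\sigma$-algebra generated by $M$ (that is, by the variables $M(z)$, $z\in\mathbb{R}^d$), then for every $\varepsilon>2\varepsilon'$ $$\Pr(Z\ge\varepsilon)\le\exp\left(\frac{-k\varepsilon^2}{8(\gamma+\gamma_m)^2\sigma^2}\right),$$ where the probability is over both $M$ and $X_1,\dots,X_k$ (if $\gamma+\gamma_m=0$, the right-hand side is to be read as the trivial bound $1$). -/

import Mathlib

open MeasureTheory ProbabilityTheory
open scoped NNReal

noncomputable section

/-- `M` is a naturally-occurring change of the model `m : ℝᵈ → ℝ`. The updated model is a random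
function `ω ↦ M ω` on the probability space `(Ω, P)`, that is, each `M · z` is a random variable
(measurability is with respect to the product σ-algebra on functions).
The set `𝒳` is the data manifold and `ν` the bound for the variance on it. -/
structure IsNaturalModelChange {Ω : Type*} [MeasurableSpace Ω] (P : Measure Ω) {d : ℕ}
    (𝒳 : Set (EuclideanSpace ℝ (Fin d))) (ν : ℝ) (γm γ : ℝ≥0)
    (m : EuclideanSpace ℝ (Fin d) → ℝ) (M : Ω → EuclideanSpace ℝ (Fin d) → ℝ) : Prop where
  measurable : Measurable M
  /-- `E[M(z)] = m(z)` at each fixed point `z`. -/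
  mean_eq : ∀ z, ∫ ω, M ω z ∂P = m z
  /-- If `m` is `γm`-Lipschitz, then every updated model is `γ`-Lipschitz, with one constant `γ`. -/
  lipschitz : LipschitzWith γm m → ∀ ω, LipschitzWith γ (M ω)
  /-- The variance `ν_z` of `M(z)` is at most `ν` on the data manifold. -/
  variance_le : ∀ z ∈ 𝒳, variance (fun ω => M ω z) P ≤ ν

/-- `Z = (1/k) ∑ᵢ (m(Xᵢ) - M(Xᵢ))` -/
def modelDeviation {Ω : Type*} {d k : ℕ} (m : EuclideanSpace ℝ (Fin d) → ℝ)
    (M : Ω → EuclideanSpace ℝ (Fin d) → ℝ) (X : Fin k → Ω → EuclideanSpace ℝ (Fin d)) (ω : Ω) : ℝ :=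
  (1 / (k : ℝ)) * ∑ i, (m (X i ω) - M ω (X i ω))

end

/-! Freeze the realization of `M`. Then `Z` averages `k` independent values of the bounded `(γm +
γ)`-Lipschitz function `m - M`, so Gaussian concentration and Chernoff control `Z - E[Z | M]`. By
independence `E[Z | M]` is the Gaussian integral of `m - M`, and Fubini with `E[M(z)] = m(z)` gives
`E[Z] = 0`. Hence `E[Z | M] < ε' < ε/2`, so `Z ≥ ε` forces a deviation of at least `ε/2`, uniformly
in the frozen `M`.

Concentration with the sharp constant comes from a covariance bound, `Cov(h, g) ≤ L E‖∇g‖` for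
`L`-Lipschitz `h`, proved by rotating an independent pair `(X, Y)`
(`integral_mul_sub_le_of_lipschitz`). Taking `g = exp(t h)` gives a differential inequality for `log
mgf` (`mgf_le_of_lipschitz`). -/

theorem pi_fin_absolutelyContinuous {n : ℕ} {μ ν : Measure ℝ} [SigmaFinite μ] [SigmaFinite ν]
    (h : μ ≪ ν) : Measure.pi (fun _ : Fin n => μ) ≪ Measure.pi (fun _ : Fin n => ν) := by
  induction n with
  | zero =>
    rw [Measure.pi_of_empty, Measure.pi_of_empty]
  | succ n ih =>
    have h1 := (measurePreserving_piFinSuccAbove (fun _ : Fin (n + 1) => μ) 0).symm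
    have h2 := (measurePreserving_piFinSuccAbove (fun _ : Fin (n + 1) => ν) 0).symm
    rw [← h1.map_eq, ← h2.map_eq]
    exact (h.prod ih).map (MeasurableEquiv.measurable _)

/-! ### Standard Gaussian: absolute continuity, linear functionals, rotations -/

section StdGaussian

variable {E : Type*} [NormedAddCommGroup E] [InnerProductSpace ℝ E] [FiniteDimensional ℝ E]
  [MeasurableSpace E] [BorelSpace E]

variable (E) in
-- Lets Rademacher's theorem, an a.e. statement for Lebesgue measure, be used under the Gaussian.
theorem stdGaussian_absolutelyContinuous : stdGaussian E ≪ (volume : Measure E) := by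
  have hE : stdGaussian (EuclideanSpace ℝ (Fin (Module.finrank ℝ E))) ≪ volume := by
    rw [← map_pi_eq_stdGaussian, ← (PiLp.volume_preserving_toLp _).map_eq, volume_pi]
    exact (pi_fin_absolutelyContinuous
      (gaussianReal_absolutelyContinuous 0 one_ne_zero)).map (by fun_prop)
  let e := (stdOrthonormalBasis ℝ E).repr.symm
  rw [← stdGaussian_map e, ← e.measurePreserving.map_eq]
  exact hE.map (by fun_prop)

theorem integral_dual_sq_stdGaussian (ℓ : StrongDual ℝ E) :
    ∫ v, ℓ v ^ 2 ∂(stdGaussian E) = ‖ℓ‖ ^ 2 := by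
  rw [← variance_dual_stdGaussian, variance_of_integral_eq_zero (by fun_prop)
    (integral_strongDual_stdGaussian ℓ)]

theorem memLp_two_dual_stdGaussian (ℓ : StrongDual ℝ E) : MemLp ℓ 2 (stdGaussian E) :=
  (IsGaussian.memLp_two_id (μ := stdGaussian E)).continuousLinearMap_comp ℓ

theorem integrable_dual_stdGaussian (ℓ : StrongDual ℝ E) : Integrable ℓ (stdGaussian E) :=
  (memLp_two_dual_stdGaussian ℓ).integrable (by norm_num)

/-- A substitute for Gaussian integration by parts that never differentiates `h`: reflect in the
hyperplane `ker ℓ`. The law is invariant and `ℓ` changes sign, so only the difference `h v - h (R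
v)` contributes, and the Lipschitz bound makes it linear in `|ℓ v|`. -/
theorem abs_integral_mul_dual_le {h : E → ℝ} {L : ℝ≥0} (hL : LipschitzWith L h) {B : ℝ}
    (hB : ∀ x, |h x| ≤ B) (ℓ : StrongDual ℝ E) :
    |∫ v, h v * ℓ v ∂(stdGaussian E)| ≤ L * ‖ℓ‖ := by
  obtain rfl | hℓ := eq_or_ne ℓ 0
  · simp
  obtain ⟨a, rfl⟩ := (InnerProductSpace.toDual ℝ E).surjective ℓ
  have ha : a ≠ 0 := by rintro rfl; simp at hℓ
  have ha' : 0 < ‖a‖ := norm_pos_iff.2 ha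
  set ℓ := InnerProductSpace.toDual ℝ E a with hℓdef
  have hℓa : ∀ v, ℓ v = inner ℝ a v := fun v => by simp [hℓdef]
  let R : E ≃ₗᵢ[ℝ] E := (ℝ ∙ a)ᗮ.reflection
  have hR : ∀ v, R v = v - (2 * (inner ℝ a v / ‖a‖ ^ 2)) • a := fun v => by
    have h := Submodule.starProjection_singleton ℝ (v := a) v
    simp only [RCLike.ofReal_real_eq_id, id_eq] at h
    change (ℝ ∙ a)ᗮ.reflection v = _
    rw [Submodule.reflection_orthogonal_apply, Submodule.reflection_apply, h]
    module
  have hℓR : ∀ v, ℓ (R v) = - ℓ v := fun v => by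
    rw [hℓa, hR, hℓa, inner_sub_right, inner_smul_right, real_inner_self_eq_norm_sq]
    field_simp
    ring
  have hRmp : MeasurePreserving R (stdGaussian E) (stdGaussian E) :=
    ⟨by fun_prop, stdGaussian_map R⟩
  have hint : ∀ f : E → ℝ, Continuous f → (∀ x, |f x| ≤ B) →
      Integrable (fun v => f v * ℓ v) (stdGaussian E) := fun f hf hfB =>
    (integrable_dual_stdGaussian ℓ).bdd_mul (c := B) hf.aestronglyMeasurable
      (Filter.Eventually.of_forall hfB)
  have h1 : ∫ v, h v * ℓ v ∂(stdGaussian E) = - ∫ v, h (R v) * ℓ v ∂(stdGaussian E) := by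
    rw [← hRmp.integral_comp R.toHomeomorph.measurableEmbedding, ← integral_neg]
    exact integral_congr_ae (Filter.Eventually.of_forall fun v => by simp [hℓR])
  have h2 : 2 * ∫ v, h v * ℓ v ∂(stdGaussian E)
      = ∫ v, (h v - h (R v)) * ℓ v ∂(stdGaussian E) := by
    simp_rw [sub_mul]
    rw [integral_sub (hint _ hL.continuous hB)
      (hint (fun v => h (R v)) (hL.continuous.comp R.continuous) fun x => hB _)]
    linarith
  have h3 : |∫ v, (h v - h (R v)) * ℓ v ∂(stdGaussian E)|
      ≤ ∫ v, (2 * L / ‖a‖) * ℓ v ^ 2 ∂(stdGaussian E) := by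
    rw [← Real.norm_eq_abs]
    refine norm_integral_le_of_norm_le ((memLp_two_dual_stdGaussian ℓ).integrable_sq.const_mul _)
      (Filter.Eventually.of_forall fun v => ?_)
    have h4 : |h v - h (R v)| ≤ L * (2 * (|ℓ v| / ‖a‖)) := by
      have := hL.dist_le_mul v (R v)
      rw [Real.dist_eq, dist_eq_norm v, show v - R v = (2 * (ℓ v / ‖a‖ ^ 2)) • a by
        rw [hR, hℓa, sub_sub_cancel], norm_smul] at this
      refine this.trans_eq ?_
      rw [Real.norm_eq_abs, abs_mul, abs_two, abs_div, abs_of_pos (pow_pos ha' 2)]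
      field_simp
    rw [norm_mul, Real.norm_eq_abs, Real.norm_eq_abs, ← sq_abs]
    calc _ ≤ L * (2 * (|ℓ v| / ‖a‖)) * |ℓ v| := by gcongr
      _ = _ := by ring
  rw [integral_const_mul, integral_dual_sq_stdGaussian, ← h2, abs_mul, abs_two] at h3
  have hn : ‖ℓ‖ = ‖a‖ := by simp [hℓdef]
  rw [hn] at h3 ⊢
  have : 2 * L / ‖a‖ * ‖a‖ ^ 2 = 2 * (L * ‖a‖) := by field_simp
  linarith

/-- The rotation of `E × E` by the angle `θ` preserves the product of two standard Gaussians. -/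
theorem measurePreserving_rotation_stdGaussian (θ : ℝ) :
    MeasurePreserving (ContinuousLinearMap.rotation (E := E) θ)
      ((stdGaussian E).prod (stdGaussian E)) ((stdGaussian E).prod (stdGaussian E)) :=
  ⟨by fun_prop, IsGaussian.map_rotation_eq_self (by simp) θ⟩

end StdGaussian

theorem integrable_norm_fderiv_of_lipschitz {E : Type*} [NormedAddCommGroup E] [NormedSpace ℝ E]
    [MeasurableSpace E] [OpensMeasurableSpace E] {g : E → ℝ} {K : ℝ≥0} (hK : LipschitzWith K g)
    (μ : Measure E) [IsFiniteMeasure μ] : Integrable (fun x => ‖fderiv ℝ g x‖) μ :=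
  Integrable.of_bound (measurable_fderiv ℝ g).norm.aestronglyMeasurable (K : ℝ)
    (Filter.Eventually.of_forall fun x => by
      rw [norm_norm]; exact norm_fderiv_le_of_lipschitz ℝ hK)

/-! ### Covariance bound by rotation -/

section Covariance

variable {E : Type*} [NormedAddCommGroup E] [InnerProductSpace ℝ E] [FiniteDimensional ℝ E]
  [MeasurableSpace E] [BorelSpace E]

local notation "γ" => stdGaussian E

theorem integrable_mul_fderiv_apply_snd {g : E → ℝ} {K : ℝ≥0} (hK : LipschitzWith K g)
    {f : E × E → ℝ} (hf : Continuous f) {B : ℝ} (hB : ∀ p, |f p| ≤ B) :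
    Integrable (fun p : E × E => f p * fderiv ℝ g p.1 p.2) ((γ).prod γ) := by
  have hsnd : Integrable (fun p : E × E => K * ‖p.2‖) ((γ).prod γ) :=
    ((IsGaussian.integrable_id (μ := γ)).norm.comp_snd γ).const_mul _
  have hm : Measurable fun p : E × E => fderiv ℝ g p.1 p.2 := by
    have h1 : Measurable fun p : E × E => (fderiv ℝ g p.1, p.2) :=
      ((measurable_fderiv ℝ g).comp measurable_fst).prodMk measurable_snd
    exact (isBoundedBilinearMap_apply (𝕜 := ℝ) (E := E) (F := ℝ)).continuous.measurable.comp h1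
  refine (hsnd.mono' hm.aestronglyMeasurable (Filter.Eventually.of_forall fun p => ?_)).bdd_mul
    (c := B) hf.aestronglyMeasurable (Filter.Eventually.of_forall hB)
  exact ((fderiv ℝ g p.1).le_opNorm p.2).trans
    (mul_le_mul_of_nonneg_right (norm_fderiv_le_of_lipschitz ℝ hK) (norm_nonneg _))

/-- The derivative of `θ ↦ E[h(X) g(cos θ • X + sin θ • Y)]`, in the rotated coordinates. -/
theorem hasDerivAt_integral_mul_rotation {h g : E → ℝ} {L K : ℝ≥0} (hL : LipschitzWith L h)
    (hK : LipschitzWith K g) {B : ℝ} (hB : ∀ x, |h x| ≤ B) {C : ℝ} (hC : ∀ x, |g x| ≤ C) (θ : ℝ) :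
    HasDerivAt (fun θ : ℝ => ∫ p : E × E, h p.1 * g (Real.cos θ • p.1 + Real.sin θ • p.2)
        ∂((γ).prod γ))
      (∫ p : E × E, h (Real.cos θ • p.1 - Real.sin θ • p.2) * fderiv ℝ g p.1 p.2
        ∂((γ).prod γ)) θ := by
  have hrot := measurePreserving_rotation_stdGaussian (E := E) θ
  have hB0 : 0 ≤ B := (abs_nonneg _).trans (hB 0)
  have hback : ∀ p : E × E, Real.cos θ • (ContinuousLinearMap.rotation θ p).1
      - Real.sin θ • (ContinuousLinearMap.rotation θ p).2 = p.1 := fun p => by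
    simp only [ContinuousLinearMap.rotation_apply]
    have := Real.cos_sq_add_sin_sq θ
    calc _ = (Real.cos θ ^ 2 + Real.sin θ ^ 2) • p.1 := by module
      _ = _ := by rw [this, one_smul]
  -- `G` composed with the rotation is the pointwise `θ`-derivative of the integrand; invariance of
  -- the law removes the rotation.
  let G : E × E → ℝ := fun p => h (Real.cos θ • p.1 - Real.sin θ • p.2) * fderiv ℝ g p.1 p.2
  have hG : Integrable G ((γ).prod γ) := integrable_mul_fderiv_apply_snd hK
    (f := fun p => h (Real.cos θ • p.1 - Real.sin θ • p.2))
    (hL.continuous.comp (by fun_prop)) fun p => hB _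
  have hGrot : ∫ p, G (ContinuousLinearMap.rotation θ p) ∂((γ).prod γ)
      = ∫ p, G p ∂((γ).prod γ) := by
    rw [← integral_map hrot.measurable.aemeasurable (by rw [hrot.map_eq]; exact hG.1), hrot.map_eq]
  change HasDerivAt _ (∫ p, G p ∂((γ).prod γ)) θ
  rw [← hGrot]
  -- The rotated first coordinate is again standard Gaussian, so Rademacher applies to it almost
  -- surely.
  have hdiff : ∀ᵐ p ∂((γ).prod γ), DifferentiableAt ℝ g (ContinuousLinearMap.rotation θ p).1 :=
    (Measure.quasiMeasurePreserving_fst.comp hrot.quasiMeasurePreserving).ae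
      ((stdGaussian_absolutelyContinuous E).ae_le hK.ae_differentiableAt)
  have hc : ∀ t, Continuous fun p : E × E => h p.1 * g (Real.cos t • p.1 + Real.sin t • p.2) :=
    fun t => (hL.continuous.comp continuous_fst).mul (hK.continuous.comp (by fun_prop))
  refine (hasDerivAt_integral_of_dominated_loc_of_lip (s := Set.univ)
    (bound := fun p => B * (K * (‖p.1‖ + ‖p.2‖))) Filter.univ_mem
    (Filter.Eventually.of_forall fun t => (hc t).aestronglyMeasurable) ?_
    ((hrot.integrable_comp hG.1).2 hG).1 (Filter.Eventually.of_forall fun p => ?_) ?_ ?_).2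
  · refine Integrable.of_bound (hc θ).aestronglyMeasurable (B * C)
      (Filter.Eventually.of_forall fun p => ?_)
    rw [norm_mul]
    exact mul_le_mul (hB _) (hC _) (norm_nonneg _) hB0
  · rw [lipschitzOnWith_univ]
    refine LipschitzWith.of_dist_le_mul fun s t => ?_
    rw [Real.coe_nnabs, abs_of_nonneg (by positivity), Real.dist_eq, ← mul_sub, abs_mul, mul_assoc,
      mul_assoc]
    refine mul_le_mul (hB _) ?_ (abs_nonneg _) hB0
    rw [← Real.dist_eq]
    refine (hK.dist_le_mul _ _).trans (mul_le_mul_of_nonneg_left ?_ K.2)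
    rw [dist_eq_norm, show Real.cos s • p.1 + Real.sin s • p.2
      - (Real.cos t • p.1 + Real.sin t • p.2)
      = (Real.cos s - Real.cos t) • p.1 + (Real.sin s - Real.sin t) • p.2 by module]
    refine (norm_add_le _ _).trans ?_
    rw [norm_smul, norm_smul, Real.norm_eq_abs, Real.norm_eq_abs, Real.dist_eq, add_mul,
      mul_comm ‖p.1‖, mul_comm ‖p.2‖]
    have hcos := Real.lipschitzWith_cos.dist_le_mul s t
    have hsin := Real.lipschitzWith_sin.dist_le_mul s t
    simp only [NNReal.coe_one, one_mul, Real.dist_eq] at hcos hsin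
    gcongr
  · have hn := (IsGaussian.integrable_id (μ := γ)).norm
    exact (((hn.comp_fst γ).add (hn.comp_snd γ)).const_mul _).const_mul _
  · filter_upwards [hdiff] with p hp
    simp only [G, Function.comp_apply]
    rw [hback]
    refine HasDerivAt.const_mul (h p.1) ?_
    have h1 : HasDerivAt (fun t : ℝ => Real.cos t • p.1 + Real.sin t • p.2)
        (ContinuousLinearMap.rotation θ p).2 θ :=
      ((Real.hasDerivAt_cos θ).smul_const p.1).add ((Real.hasDerivAt_sin θ).smul_const p.2)
    exact HasFDerivAt.comp_hasDerivAt θ hp.hasFDerivAt h1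

/-- For fixed `u`, the map `v ↦ h (cos θ • u - sin θ • v)` is `L |sin θ|`-Lipschitz, so the
reflection bound applies with `ℓ = fderiv ℝ g u`. -/
theorem abs_integral_rotated_le {h g : E → ℝ} {L K : ℝ≥0} (hL : LipschitzWith L h)
    (hK : LipschitzWith K g) {B : ℝ} (hB : ∀ x, |h x| ≤ B) (θ : ℝ) :
    |∫ p : E × E, h (Real.cos θ • p.1 - Real.sin θ • p.2) * fderiv ℝ g p.1 p.2 ∂((γ).prod γ)|
      ≤ |Real.sin θ| * (L * ∫ u, ‖fderiv ℝ g u‖ ∂γ) := by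
  rw [integral_prod _ (integrable_mul_fderiv_apply_snd hK
    (f := fun p => h (Real.cos θ • p.1 - Real.sin θ • p.2))
    (hL.continuous.comp (by fun_prop)) fun p => hB _), ← integral_const_mul, ← integral_const_mul,
    ← Real.norm_eq_abs]
  refine norm_integral_le_of_norm_le
    (((integrable_norm_fderiv_of_lipschitz hK _).const_mul _).const_mul _)
    (Filter.Eventually.of_forall fun u => ?_)
  have hlip : LipschitzWith (L * Real.nnabs (Real.sin θ))
      (fun v => h (Real.cos θ • u - Real.sin θ • v)) := by
    refine hL.comp (LipschitzWith.of_dist_le_mul fun v w => ?_)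
    rw [dist_sub_left, dist_smul₀, Real.coe_nnabs, Real.norm_eq_abs]
  refine (abs_integral_mul_dual_le hlip (fun v => hB _) (fderiv ℝ g u)).trans_eq ?_
  rw [NNReal.coe_mul, Real.coe_nnabs]
  ring

/-- The covariance of two bounded Lipschitz functions under the standard Gaussian measure. -/
theorem integral_mul_sub_le_of_lipschitz {h g : E → ℝ} {L K : ℝ≥0} (hL : LipschitzWith L h)
    (hK : LipschitzWith K g) {B : ℝ} (hB : ∀ x, |h x| ≤ B) {C : ℝ} (hC : ∀ x, |g x| ≤ C) :
    ∫ x, h x * g x ∂γ - (∫ x, h x ∂γ) * ∫ x, g x ∂γ ≤ L * ∫ u, ‖fderiv ℝ g u‖ ∂γ := by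
  set D := L * ∫ u, ‖fderiv ℝ g u‖ ∂γ with hD
  let φ : ℝ → ℝ := fun θ => ∫ p : E × E, h p.1 * g (Real.cos θ • p.1 + Real.sin θ • p.2)
        ∂((γ).prod γ)
  have hφ := fun θ => hasDerivAt_integral_mul_rotation hL hK hB hC θ
  have hψ : ∀ θ, HasDerivAt (fun θ => φ θ - D * Real.cos θ) _ θ :=
    fun θ => (hφ θ).sub ((Real.hasDerivAt_cos θ).const_mul D)
  -- `φ' ≥ -D sin θ` on the quarter turn, and `D cos θ` has derivative `-D sin θ`. The endpoints are
  -- `E[hg]` and `E[h] E[g]`.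
  have hmono : MonotoneOn (fun θ => φ θ - D * Real.cos θ) (Set.Icc 0 (Real.pi / 2)) := by
    refine monotoneOn_of_deriv_nonneg (convex_Icc _ _)
      (fun θ _ => (hψ θ).continuousAt.continuousWithinAt)
      (fun θ _ => (hψ θ).differentiableAt.differentiableWithinAt) fun θ hθ => ?_
    rw [interior_Icc] at hθ
    rw [(hψ θ).deriv]
    have h1 := abs_le.1 (abs_integral_rotated_le hL hK hB θ)
    rw [abs_of_nonneg (Real.sin_nonneg_of_nonneg_of_le_pi hθ.1.le
      (by linarith [hθ.2, Real.pi_pos]))] at h1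
    linarith [h1.1]
  have h0 := hmono (Set.left_mem_Icc.2 (by positivity)) (Set.right_mem_Icc.2 (by positivity))
    (by positivity : (0 : ℝ) ≤ Real.pi / 2)
  have hφ0 : φ 0 = ∫ x, h x * g x ∂γ := by
    simp only [φ, Real.cos_zero, Real.sin_zero, one_smul, zero_smul, add_zero]
    rw [integral_fun_fst (fun x => h x * g x)]
    simp
  have hφ1 : φ (Real.pi / 2) = (∫ x, h x ∂γ) * ∫ x, g x ∂γ := by
    simp only [φ, Real.cos_pi_div_two, Real.sin_pi_div_two, one_smul, zero_smul, zero_add]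
    exact integral_prod_mul h g
  simp only [Real.cos_zero, Real.cos_pi_div_two, hφ0, hφ1] at h0
  linarith

end Covariance

/-! ### Exponential moments of Lipschitz functions -/

theorem Real.abs_exp_sub_exp_le {a b c : ℝ} (ha : a ≤ c) (hb : b ≤ c) :
    |Real.exp a - Real.exp b| ≤ Real.exp c * |a - b| := by
  have key : ∀ a b : ℝ, a ≤ c → b ≤ a → Real.exp a - Real.exp b ≤ Real.exp c * (a - b) := by
    intro a b ha hba
    have h1 : Real.exp b = Real.exp a * Real.exp (b - a) := by
      rw [← Real.exp_add, add_sub_cancel]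
    have h2 : 1 - Real.exp (b - a) ≤ a - b := by linarith [Real.add_one_le_exp (b - a)]
    calc Real.exp a - Real.exp b = Real.exp a * (1 - Real.exp (b - a)) := by rw [h1]; ring
      _ ≤ Real.exp a * (a - b) := by gcongr
      _ ≤ Real.exp c * (a - b) := by
        have := sub_nonneg.2 hba
        gcongr
  rcases le_total b a with h | h
  · rw [abs_of_nonneg (sub_nonneg.2 (Real.exp_le_exp.2 h)), abs_of_nonneg (sub_nonneg.2 h)]
    exact key a b ha h
  · rw [abs_sub_comm, abs_sub_comm a, abs_of_nonneg (sub_nonneg.2 (Real.exp_le_exp.2 h)),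
      abs_of_nonneg (sub_nonneg.2 h)]
    exact key b a hb h

section Subgaussian

variable {E : Type*} [NormedAddCommGroup E] [InnerProductSpace ℝ E] [FiniteDimensional ℝ E]
  [MeasurableSpace E] [BorelSpace E]

theorem integrable_exp_mul_of_continuous_of_bounded {X : Type*} [TopologicalSpace X]
    [MeasurableSpace X] [OpensMeasurableSpace X] {h : X → ℝ} (hc : Continuous h) {B : ℝ}
    (hB : ∀ x, |h x| ≤ B) (μ : Measure X) [IsFiniteMeasure μ] (t : ℝ) :
    Integrable (fun x => Real.exp (t * h x)) μ := by
  refine Integrable.of_bound (by fun_prop) (Real.exp (|t| * B))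
    (Filter.Eventually.of_forall fun x => ?_)
  rw [Real.norm_eq_abs, Real.abs_exp]
  refine Real.exp_le_exp.2 ((le_abs_self _).trans ?_)
  rw [abs_mul]
  exact mul_le_mul_of_nonneg_left (hB x) (abs_nonneg t)

theorem integral_mul_exp_sub_le {h : E → ℝ} {L : ℝ≥0} (hL : LipschitzWith L h) {B : ℝ}
    (hB : ∀ x, |h x| ≤ B) {t : ℝ} (ht : 0 ≤ t) :
    ∫ x, h x * Real.exp (t * h x) ∂(stdGaussian E)
        - (∫ x, h x ∂(stdGaussian E)) * mgf h (stdGaussian E) t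
      ≤ L ^ 2 * t * mgf h (stdGaussian E) t := by
  have hint := integrable_exp_mul_of_continuous_of_bounded hL.continuous hB (stdGaussian E) t
  have hle : ∀ x, t * h x ≤ t * B := fun x =>
    mul_le_mul_of_nonneg_left ((le_abs_self _).trans (hB x)) ht
  -- Boundedness of `h` makes `exp (t h)` Lipschitz. `K` does not enter the bound, which uses the
  -- pointwise gradient estimate `t L exp (t h)`.
  let K : ℝ≥0 := Real.toNNReal (Real.exp (t * B) * (t * L))
  have hK : LipschitzWith K (fun x => Real.exp (t * h x)) := by
    refine LipschitzWith.of_dist_le_mul fun x y => ?_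
    rw [Real.coe_toNNReal _ (by positivity), Real.dist_eq, mul_assoc, mul_assoc]
    refine (Real.abs_exp_sub_exp_le (hle x) (hle y)).trans ?_
    refine mul_le_mul_of_nonneg_left ?_ (Real.exp_pos _).le
    rw [← mul_sub, abs_mul, abs_of_nonneg ht]
    exact mul_le_mul_of_nonneg_left (hL.dist_le_mul x y) ht
  have hcov := integral_mul_sub_le_of_lipschitz hL hK hB (C := Real.exp (t * B)) fun x => by
    rw [Real.abs_exp]; exact Real.exp_le_exp.2 (hle x)
  refine hcov.trans ?_
  have hgrad : ∫ u, ‖fderiv ℝ (fun x => Real.exp (t * h x)) u‖ ∂(stdGaussian E)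
      ≤ ∫ u, (t * L) * Real.exp (t * h u) ∂(stdGaussian E) := by
    refine integral_mono_ae (integrable_norm_fderiv_of_lipschitz hK _) (hint.const_mul _) ?_
    filter_upwards [(stdGaussian_absolutelyContinuous E).ae_le hL.ae_differentiableAt] with u hu
    rw [((hu.hasFDerivAt.const_mul t).exp).fderiv, norm_smul, norm_smul, Real.norm_eq_abs,
      Real.abs_exp, Real.norm_eq_abs, abs_of_nonneg ht, mul_comm]
    have := norm_fderiv_le_of_lipschitz ℝ hL (x₀ := u)
    gcongr
  rw [integral_const_mul] at hgrad
  calc _ ≤ (L : ℝ) * (t * L * mgf h (stdGaussian E) t) := mul_le_mul_of_nonneg_left hgrad L.2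
    _ = _ := by ring

/-- Herbst-type argument: the covariance bound says `(log mgf)' ≤ A + L² s` for `s > 0`; integrate
from `0`. -/
theorem mgf_le_of_lipschitz {h : E → ℝ} {L : ℝ≥0} (hL : LipschitzWith L h) {B : ℝ}
    (hB : ∀ x, |h x| ≤ B) {t : ℝ} (ht : 0 ≤ t) :
    mgf h (stdGaussian E) t ≤ Real.exp (t * ∫ x, h x ∂(stdGaussian E) + L ^ 2 * t ^ 2 / 2) := by
  have hint := integrable_exp_mul_of_continuous_of_bounded hL.continuous hB (stdGaussian E)
  set A := ∫ x, h x ∂(stdGaussian E)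
  have hset : integrableExpSet h (stdGaussian E) = Set.univ := Set.eq_univ_of_forall hint
  have hpos : ∀ s, 0 < mgf h (stdGaussian E) s := fun s => mgf_pos (hint s)
  have hψ : ∀ s, HasDerivAt (fun s => Real.log (mgf h (stdGaussian E) s)
      - (s * A + L ^ 2 * s ^ 2 / 2)) _ s := fun s =>
    ((hasDerivAt_mgf (by rw [hset, interior_univ]; trivial)).log (hpos s).ne').sub
      (((hasDerivAt_id s).mul_const A).add
        ((((hasDerivAt_id s).pow 2).const_mul ((L : ℝ) ^ 2)).div_const 2))
  have hanti : AntitoneOn (fun s => Real.log (mgf h (stdGaussian E) s)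
      - (s * A + L ^ 2 * s ^ 2 / 2)) (Set.Ici 0) := by
    refine antitoneOn_of_deriv_nonpos (convex_Ici _)
      (fun s _ => (hψ s).continuousAt.continuousWithinAt)
      (fun s _ => (hψ s).differentiableAt.differentiableWithinAt) fun s hs => ?_
    rw [interior_Ici] at hs
    rw [(hψ s).deriv, sub_nonpos, div_le_iff₀ (hpos s)]
    have := integral_mul_exp_sub_le hL hB (le_of_lt hs)
    simp only [id_eq, Nat.cast_ofNat, Nat.add_one_sub_one, pow_one, one_mul, mul_one]
    linarith
  have h0 := hanti (Set.mem_Ici.2 le_rfl) (Set.mem_Ici.2 ht) ht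
  simp only [mgf_zero, Real.log_one] at h0
  rw [← Real.log_le_iff_le_exp (hpos t)]
  linarith

/-- Gaussian concentration: a bounded `L`-Lipschitz function is sub-Gaussian with parameter `L²`
under the standard Gaussian measure. -/
theorem hasSubgaussianMGF_stdGaussian {h : E → ℝ} {L : ℝ≥0} (hL : LipschitzWith L h) {B : ℝ}
    (hB : ∀ x, |h x| ≤ B) :
    HasSubgaussianMGF (fun x => h x - ∫ y, h y ∂(stdGaussian E)) (L ^ 2) (stdGaussian E) := by
  have hint := integrable_exp_mul_of_continuous_of_bounded hL.continuous hB (stdGaussian E)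
  set A := ∫ y, h y ∂(stdGaussian E) with hA
  have hexp : ∀ t x, Real.exp (t * (h x - A)) = Real.exp (t * h x) * Real.exp (-(t * A)) :=
    fun t x => by rw [← Real.exp_add]; ring_nf
  refine ⟨fun t => by simp_rw [hexp]; exact (hint t).mul_const _, fun t => ?_⟩
  have hle : mgf h (stdGaussian E) t ≤ Real.exp (t * A + L ^ 2 * t ^ 2 / 2) := by
    rcases le_total 0 t with ht | ht
    · exact mgf_le_of_lipschitz hL hB ht
    · have := mgf_le_of_lipschitz (h := -h) hL.neg (B := B) (fun x => by simpa using hB x)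
        (neg_nonneg.2 ht)
      rw [mgf_neg, neg_neg] at this
      simpa [integral_neg, hA] using this
  rw [mgf]
  simp_rw [hexp]
  rw [integral_mul_const]
  calc _ ≤ Real.exp (t * A + L ^ 2 * t ^ 2 / 2) * Real.exp (-(t * A)) :=
        mul_le_mul_of_nonneg_right hle (Real.exp_pos _).le
    _ = _ := by rw [← Real.exp_add]; push_cast; ring_nf

end Subgaussian

/-! ### Transfer to the Gaussian with mean `x` and covariance `σ² I` -/

theorem multivariateGaussian_sq_smul_one {ι : Type*} [Fintype ι] [DecidableEq ι]
    (x : EuclideanSpace ℝ ι) (σ : ℝ) :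
    multivariateGaussian x (σ ^ 2 • (1 : Matrix ι ι ℝ))
      = (stdGaussian (EuclideanSpace ℝ ι)).map (fun y => x + σ • y) := by
  have hS : (σ ^ 2 • (1 : Matrix ι ι ℝ)).PosSemidef := Matrix.PosSemidef.one.smul (sq_nonneg σ)
  have hmap : (fun y : EuclideanSpace ℝ ι => x + σ • y) = (fun y => x + y) ∘ fun y => σ • y := rfl
  apply Measure.ext_of_charFun
  ext t
  rw [charFun_multivariateGaussian hS, hmap,
    ← Measure.map_map (measurable_const_add x) (by fun_prop), charFun_map_const_add,
    charFun_map_smul, charFun_stdGaussian, ← Complex.exp_add]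
  congr 1
  have hq : t.ofLp ⬝ᵥ ((σ ^ 2 • (1 : Matrix ι ι ℝ)).mulVec t.ofLp) = (‖σ‖ * ‖t‖) ^ 2 := by
    rw [mul_pow, EuclideanSpace.real_norm_sq_eq, Matrix.smul_mulVec, Matrix.one_mulVec,
      dotProduct_smul, smul_eq_mul, Real.norm_eq_abs, sq_abs]
    simp [dotProduct, pow_two]
  rw [norm_smul, hq, real_inner_comm x t]
  push_cast
  ring

theorem hasSubgaussianMGF_multivariateGaussian {ι : Type*} [Fintype ι] [DecidableEq ι]
    (x : EuclideanSpace ℝ ι) {σ : ℝ} (hσ : 0 ≤ σ) {h : EuclideanSpace ℝ ι → ℝ} {L : ℝ≥0}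
    (hL : LipschitzWith L h) {B : ℝ} (hB : ∀ x, |h x| ≤ B) :
    HasSubgaussianMGF
      (fun y => h y - ∫ z, h z ∂(multivariateGaussian x (σ ^ 2 • (1 : Matrix ι ι ℝ))))
      ((L * σ.toNNReal) ^ 2) (multivariateGaussian x (σ ^ 2 • (1 : Matrix ι ι ℝ))) := by
  have hlip : LipschitzWith (L * σ.toNNReal) (fun y => h (x + σ • y)) := by
    refine hL.comp (LipschitzWith.of_dist_le_mul fun v w => ?_)
    rw [dist_add_left, dist_smul₀, Real.coe_toNNReal _ hσ, Real.norm_eq_abs, abs_of_nonneg hσ]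
  have h1 := hasSubgaussianMGF_stdGaussian hlip fun y => hB _
  have hm : AEMeasurable (fun y => x + σ • y) (stdGaussian (EuclideanSpace ℝ ι)) := by fun_prop
  have hc := hL.continuous
  rw [multivariateGaussian_sq_smul_one x σ, integral_map hm (by fun_prop)]
  refine HasSubgaussianMGF.congr_identDistrib h1 ⟨?_, ?_, ?_⟩
  · fun_prop
  · fun_prop
  · rw [AEMeasurable.map_map_of_aemeasurable (by fun_prop) hm]
    rfl

/-! ### Random functions averaged over independent points -/

theorem abs_mean_eval_le {Ω' S : Type*} {k : ℕ} {F : Ω' → S → ℝ} {B : ℝ}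
    (hB : ∀ t y, |F t y| ≤ B) (hk : 0 < k)
    (t : Ω') (x : Fin k → S) :
    |(1 / (k : ℝ)) * ∑ i, F t (x i)| ≤ B := by
  have hk' : (0 : ℝ) < k := by positivity
  rw [abs_mul, abs_of_pos (one_div_pos.2 hk'), one_div_mul_eq_div, div_le_iff₀ hk']
  refine (Finset.abs_sum_le_sum_abs _ _).trans ((Finset.sum_le_sum fun i _ => hB t (x i)).trans ?_)
  simp [mul_comm]

theorem map_eq_pi_of_hasLaw {Ω S : Type*} [MeasurableSpace Ω] [MeasurableSpace S]
    {P : Measure Ω} [IsProbabilityMeasure P] {k : ℕ} {X : Fin k → Ω → S} {ν : Measure S}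
    (hlaw : ∀ i, HasLaw (X i) ν P) (hX : iIndepFun X P) :
    P.map (fun ω i => X i ω) = Measure.pi fun _ => ν := by
  rw [(iIndepFun_iff_map_fun_eq_pi_map fun i => (hlaw i).aemeasurable).1 hX]
  simp_rw [(hlaw _).map_eq]

theorem measurable_uncurry_of_continuous_of_measurable_eval {Ω' S : Type*} [MeasurableSpace Ω']
    [TopologicalSpace S] [TopologicalSpace.MetrizableSpace S] [SecondCountableTopology S]
    [MeasurableSpace S] [OpensMeasurableSpace S] {F : Ω' → S → ℝ} (hc : ∀ t, Continuous (F t))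
    (hm : ∀ y, Measurable fun t => F t y) : Measurable (Function.uncurry F) :=
  (measurable_uncurry_of_continuous_of_measurable (u := fun y t => F t y) hc hm).comp
    measurable_swap

section RandomFunction

variable {Ω Ω' S : Type*} [MeasurableSpace Ω] [MeasurableSpace Ω'] [MeasurableSpace S]
  {P : Measure Ω} [IsProbabilityMeasure P] {k : ℕ} {T : Ω → Ω'} {X : Fin k → Ω → S}
  {ν : Measure S} [IsProbabilityMeasure ν] {F : Ω' → S → ℝ} {B : ℝ}

theorem integral_mean_eval_pi (hk : 0 < k) {f : S → ℝ} (hf : Integrable f ν) :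
    ∫ x, (1 / (k : ℝ)) * ∑ i, f (x i) ∂(Measure.pi fun _ : Fin k => ν) = ∫ y, f y ∂ν := by
  have hk' : (k : ℝ) ≠ 0 := by positivity
  rw [integral_const_mul, integral_finsetSum _ fun i _ => integrable_comp_eval hf]
  simp_rw [integral_comp_eval (μ := fun _ : Fin k => ν) hf.1]
  simp [hk']

theorem measurable_mean_eval (hF : Measurable (Function.uncurry F)) :
    Measurable fun p : Ω' × (Fin k → S) => (1 / (k : ℝ)) * ∑ i, F p.1 (p.2 i) := by
  refine (Finset.measurable_sum _ fun i _ => ?_).const_mul _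
  exact hF.comp (measurable_fst.prodMk ((measurable_pi_apply i).comp measurable_snd))

theorem condExp_mean_eval [StandardBorelSpace S] [Nonempty S] (hk : 0 < k) (hT : Measurable T)
    (hlaw : ∀ i, HasLaw (X i) ν P) (hX : iIndepFun X P) (hTX : IndepFun T (fun ω i => X i ω) P)
    (hF : Measurable (Function.uncurry F)) (hB : ∀ t y, |F t y| ≤ B) :
    P[fun ω => (1 / (k : ℝ)) * ∑ i, F (T ω) (X i ω) | MeasurableSpace.comap T inferInstance]
      =ᵐ[P] fun ω => ∫ y, F (T ω) y ∂ν := by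
  have hXm : AEMeasurable (fun ω i => X i ω) P := aemeasurable_pi_lambda _ fun i =>
    (hlaw i).aemeasurable
  have hm := measurable_mean_eval (k := k) hF
  have h1 := condExp_prod_ae_eq_integral_condDistrib hT hXm hm.stronglyMeasurable
    (Integrable.of_bound (hm.comp_aemeasurable (hT.aemeasurable.prodMk hXm)).aestronglyMeasurable B
      (Filter.Eventually.of_forall fun ω => abs_mean_eval_le hB hk _ _))
  -- Independence makes the conditional law of the points given `T` constant.
  have h2 := ae_of_ae_map hT.aemeasurable
    (condDistrib_ae_eq_of_measure_eq_compProd T hXm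
      (κ := Kernel.const Ω' (P.map fun ω i => X i ω)) (by
        rw [Measure.compProd_const,
          (indepFun_iff_map_prod_eq_prod_map_map hT.aemeasurable hXm).1 hTX]))
  filter_upwards [h1, h2] with ω h1 h2
  rw [h1, h2, Kernel.const_apply, map_eq_pi_of_hasLaw hlaw hX]
  exact integral_mean_eval_pi hk (Integrable.of_bound
    (hF.comp measurable_prodMk_left).aestronglyMeasurable B (Filter.Eventually.of_forall (hB _)))

/-- Chernoff on each section `T = t`, with a bound free of `t`, then integrate over the law of `T`.
-/
theorem measureReal_mean_eval_sub_ge_le (hk : 0 < k) (hT : Measurable T)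
    (hlaw : ∀ i, HasLaw (X i) ν P) (hX : iIndepFun X P) (hTX : IndepFun T (fun ω i => X i ω) P)
    (hF : Measurable (Function.uncurry F)) {c : ℝ≥0}
    (hsub : ∀ t, HasSubgaussianMGF (fun y => F t y - ∫ z, F t z ∂ν) c ν) {s : ℝ} (hs : 0 ≤ s) :
    P.real {ω | s ≤ (1 / (k : ℝ)) * ∑ i, F (T ω) (X i ω) - ∫ y, F (T ω) y ∂ν}
      ≤ Real.exp (-(k * s ^ 2) / (2 * c)) := by
  have hk' : (0 : ℝ) < k := by positivity
  have hXm : AEMeasurable (fun ω i => X i ω) P := aemeasurable_pi_lambda _ fun i =>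
    (hlaw i).aemeasurable
  have hA : Measurable fun t => ∫ y, F t y ∂ν :=
    (StronglyMeasurable.integral_prod_right hF.stronglyMeasurable).measurable
  let D : Set (Ω' × (Fin k → S)) :=
    {p | s ≤ (1 / (k : ℝ)) * ∑ i, F p.1 (p.2 i) - ∫ y, F p.1 y ∂ν}
  have hD : MeasurableSet D := measurableSet_le measurable_const
    ((measurable_mean_eval hF).sub (hA.comp measurable_fst))
  have hsec : ∀ t, (Measure.pi fun _ : Fin k => ν) (Prod.mk t ⁻¹' D)
      ≤ ENNReal.ofReal (Real.exp (-(k * s ^ 2) / (2 * c))) := by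
    intro t
    have hindep : iIndepFun (fun (i : Fin k) (x : Fin k → S) => F t (x i) - ∫ z, F t z ∂ν)
        (Measure.pi fun _ : Fin k => ν) :=
      iIndepFun_pi (X := fun _ y => F t y - ∫ z, F t z ∂ν) fun _ =>
        ((hF.comp measurable_prodMk_left).sub_const _).aemeasurable
    have hsub' : ∀ i ∈ Finset.univ, HasSubgaussianMGF
        (fun x : Fin k → S => F t (x i) - ∫ z, F t z ∂ν) c (Measure.pi fun _ : Fin k => ν) := by
      intro i _
      refine HasSubgaussianMGF.of_map (Y := fun x : Fin k → S => x i)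
        (X := fun y => F t y - ∫ z, F t z ∂ν) (measurable_pi_apply i).aemeasurable ?_
      rw [(measurePreserving_eval (fun _ : Fin k => ν) i).map_eq]
      exact hsub t
    have h := HasSubgaussianMGF.measure_sum_ge_le_of_iIndepFun hindep hsub' (mul_nonneg hk'.le hs)
    rw [← ofReal_measureReal]
    refine ENNReal.ofReal_le_ofReal ?_
    have hset : Prod.mk t ⁻¹' D
        = {x : Fin k → S | k * s ≤ ∑ i, (F t (x i) - ∫ z, F t z ∂ν)} := by
      ext x
      simp only [D, Set.mem_preimage, Set.mem_ofPred_eq, Finset.sum_sub_distrib, Finset.sum_const,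
        Finset.card_univ, Fintype.card_fin, nsmul_eq_mul]
      rw [← mul_le_mul_iff_of_pos_left hk', mul_sub, ← mul_assoc, mul_one_div_cancel hk'.ne',
        one_mul]
    rw [hset]
    refine h.trans_eq ?_
    congr 1
    simp only [Finset.sum_const, Finset.card_univ, Fintype.card_fin, nsmul_eq_mul, NNReal.coe_mul,
      NNReal.coe_natCast]
    rw [show -((k : ℝ) * s) ^ 2 = k * (-(k * s ^ 2)) by ring,
      show (2 : ℝ) * (k * c) = k * (2 * c) by ring, mul_div_mul_left _ _ hk'.ne']
  have hmap := (indepFun_iff_map_prod_eq_prod_map_map hT.aemeasurable hXm).1 hTX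
  rw [map_eq_pi_of_hasLaw hlaw hX] at hmap
  have hPT : IsProbabilityMeasure (P.map T) := Measure.isProbabilityMeasure_map hT.aemeasurable
  refine ENNReal.toReal_le_of_le_ofReal (Real.exp_pos _).le ?_
  calc P ((fun ω => (T ω, fun i => X i ω)) ⁻¹' D)
      = ((P.map T).prod (Measure.pi fun _ => ν)) D := by
        rw [← hmap, Measure.map_apply_of_aemeasurable (hT.aemeasurable.prodMk hXm) hD]
    _ ≤ ∫⁻ _, ENNReal.ofReal (Real.exp (-(k * s ^ 2) / (2 * c))) ∂(P.map T) := by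
        rw [Measure.prod_apply hD]
        exact lintegral_mono hsec
    _ = _ := by simp

/-- A random function `F ∘ T`, centred at each point and sub-Gaussian under `ν` for each realization,
evaluated at `k` independent points of law `ν`. -/
theorem tail_mean_eval [StandardBorelSpace S] [Nonempty S] (hk : 0 < k) (hT : Measurable T)
    (hlaw : ∀ i, HasLaw (X i) ν P) (hX : iIndepFun X P) (hTX : IndepFun T (fun ω i => X i ω) P)
    (hF : Measurable (Function.uncurry F)) (hB : ∀ t y, |F t y| ≤ B)
    (hzero : ∀ y, ∫ ω, F (T ω) y ∂P = 0) {c : ℝ≥0}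
    (hsub : ∀ t, HasSubgaussianMGF (fun y => F t y - ∫ z, F t z ∂ν) c ν)
    {Z : Ω → ℝ} (hZ : Z = fun ω => (1 / (k : ℝ)) * ∑ i, F (T ω) (X i ω)) :
    (Integrable Z P ∧ ∫ ω, Z ω ∂P = 0) ∧
    ∀ ε' : ℝ,
      (∀ᵐ ω ∂P, |(P[Z | MeasurableSpace.comap T inferInstance]) ω - ∫ ω', Z ω' ∂P| < ε') →
      ∀ ε : ℝ, 2 * ε' < ε → P.real {ω | ε ≤ Z ω} ≤ Real.exp (-(k * (ε / 2) ^ 2) / (2 * c)) := by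
  subst hZ
  have hXm : AEMeasurable (fun ω i => X i ω) P := aemeasurable_pi_lambda _ fun i =>
    (hlaw i).aemeasurable
  have hcond := condExp_mean_eval hk hT hlaw hX hTX hF hB
  have hint : Integrable (fun ω => (1 / (k : ℝ)) * ∑ i, F (T ω) (X i ω)) P :=
    Integrable.of_bound ((measurable_mean_eval hF).comp_aemeasurable
      (hT.aemeasurable.prodMk hXm)).aestronglyMeasurable B
      (Filter.Eventually.of_forall fun ω => abs_mean_eval_le hB hk _ _)
  have hFint : Integrable (Function.uncurry fun ω y => F (T ω) y) (P.prod ν) :=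
    Integrable.of_bound (hF.comp ((hT.comp measurable_fst).prodMk
      measurable_snd)).aestronglyMeasurable B (Filter.Eventually.of_forall fun p => hB _ _)
  have hmean : ∫ ω, (1 / (k : ℝ)) * ∑ i, F (T ω) (X i ω) ∂P = 0 := by
    rw [← integral_condExp hT.comap_le, integral_congr_ae hcond, integral_integral_swap hFint]
    simp [hzero]
  refine ⟨⟨hint, hmean⟩, fun ε' hε' ε hε => ?_⟩
  rw [hmean] at hε'
  -- Supplies `ε / 2 ≥ 0` for the tail bound.
  have hpos : 0 < ε' := by
    obtain ⟨ω, hω⟩ := hε'.exists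
    exact (abs_nonneg _).trans_lt hω
  refine le_trans (ENNReal.toReal_mono (measure_ne_top _ _) (measure_mono_ae ?_))
    (measureReal_mean_eval_sub_ge_le hk hT hlaw hX hTX hF hsub (s := ε / 2) (by linarith))
  filter_upwards [hε', hcond] with ω h1 h2 (h3 : ε ≤ _)
  rw [h2, sub_zero] at h1
  have h5 := (abs_lt.1 h1).2
  change ε / 2 ≤ _
  linarith

end RandomFunction

/-! ### The concentration bound for model changes -/

theorem mainTheorem2 {Ω : Type*} [MeasurableSpace Ω] (P : Measure Ω) [IsProbabilityMeasure P]
    {d k : ℕ} (hk : 0 < k)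
    (𝒳 : Set (EuclideanSpace ℝ (Fin d))) (ν : ℝ) (γm γ : ℝ≥0)
    (m : EuclideanSpace ℝ (Fin d) → ℝ) (M : Ω → EuclideanSpace ℝ (Fin d) → ℝ)
    (hm01 : ∀ z, m z ∈ Set.Icc (0 : ℝ) 1) (hM01 : ∀ ω z, M ω z ∈ Set.Icc (0 : ℝ) 1)
    (hm : LipschitzWith γm m)
    (hM : IsNaturalModelChange P 𝒳 ν γm γ m M)
    (x : EuclideanSpace ℝ (Fin d)) (σ : ℝ) (hσ : 0 < σ)
    (X : Fin k → Ω → EuclideanSpace ℝ (Fin d))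
    (hXlaw : ∀ i, HasLaw (X i) (multivariateGaussian x (σ ^ 2 • (1 : Matrix (Fin d) (Fin d) ℝ))) P)
    (hXindep : iIndepFun X P)
    (hMX : IndepFun M (fun ω i => X i ω) P) :
    (Integrable (modelDeviation m M X) P ∧ ∫ ω, modelDeviation m M X ω ∂P = 0) ∧
    ∀ ε' : ℝ,
      (∀ᵐ ω ∂P, |(P[modelDeviation m M X | MeasurableSpace.comap M inferInstance]) ω
          - ∫ ω', modelDeviation m M X ω' ∂P| < ε') →
      ∀ ε : ℝ, 2 * ε' < ε →
        P.real {ω | ε ≤ modelDeviation m M X ω} ≤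
          Real.exp (-((k : ℝ) * ε ^ 2) / (8 * ((γ : ℝ) + (γm : ℝ)) ^ 2 * σ ^ 2)) := by
  let F : Ω → EuclideanSpace ℝ (Fin d) → ℝ := fun ω y => m y - M ω y
  have hFlip : ∀ ω, LipschitzWith (γm + γ) (F ω) := fun ω => hm.sub (hM.lipschitz hm ω)
  have hFB : ∀ ω y, |F ω y| ≤ 1 := fun ω y => by
    have h1 := hm01 y
    have h2 := hM01 ω y
    rw [abs_le]
    constructor <;> simp only [F] <;> linarith [h1.1, h1.2, h2.1, h2.2]
  -- Evaluation need not be jointly measurable on the space of all functions. So `M` is replaced by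
  -- the identity into `Ω` with the σ-algebra generated by `M`: it carries the same information, and
  -- every section of `F` is continuous.
  have hFm := @measurable_uncurry_of_continuous_of_measurable_eval Ω _
    (MeasurableSpace.comap M inferInstance) _ _ _ _ _ F (fun ω => (hFlip ω).continuous)
    fun y => (((measurable_pi_apply y).comp (comap_measurable M)).const_sub (m y))
  have hTX : @IndepFun Ω Ω _ _ (MeasurableSpace.comap M inferInstance) _ id
      (fun ω i => X i ω) P := by
    rw [IndepFun_iff_Indep] at hMX
    refine (@IndepFun_iff_Indep Ω Ω _ _ (MeasurableSpace.comap M inferInstance) _ id _ P).2 ?_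
    rwa [MeasurableSpace.comap_id]
  have hMint : ∀ y, Integrable (fun ω => M ω y) P := fun y =>
    Integrable.of_bound ((measurable_pi_apply y).comp hM.measurable).aestronglyMeasurable 1
      (Filter.Eventually.of_forall fun ω => by
        rw [Real.norm_eq_abs, abs_of_nonneg (hM01 ω y).1]; exact (hM01 ω y).2)
  have hzero : ∀ y, ∫ ω, F ω y ∂P = 0 := fun y => by
    simp only [F]
    rw [integral_sub (integrable_const _) (hMint y), hM.mean_eq y]
    simp
  have h := @tail_mean_eval Ω Ω _ _ (MeasurableSpace.comap M inferInstance) _ P _ k id X _ _ F 1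
    _ _ hk (measurable_id'' hM.measurable.comap_le) hXlaw hXindep hTX hFm hFB hzero _
    (fun ω => hasSubgaussianMGF_multivariateGaussian x hσ.le (hFlip ω) (hFB ω))
    (modelDeviation m M X) rfl
  rw [MeasurableSpace.comap_id] at h
  refine ⟨h.1, fun ε' hε' ε hε => (h.2 ε' hε' ε hε).trans_eq ?_⟩
  congr 1
  push_cast
  -- `8 = 4 * 2`: the `4` from halving `ε`, the `2` from Chernoff. If `γ + γm = 0`, division by zero
  -- gives the trivial bound `exp 0 = 1`.
  rw [Real.coe_toNNReal _ hσ.le,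
    show -((k : ℝ) * ε ^ 2) = 4 * (-(k * (ε / 2) ^ 2)) by ring,
    show 8 * ((γ : ℝ) + γm) ^ 2 * σ ^ 2 = 4 * (2 * (((γm : ℝ) + γ) * σ) ^ 2) by ring,
    mul_div_mul_left _ _ (by norm_num : (4 : ℝ) ≠ 0)]
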